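/- Conventions. $\widehat g(\gamma)=\int_{\mathbb R^2} g(x)e^{-\mathrm i x\cdot\gamma}\,dx$; $\nu_2(g)=\sup\{s\in\mathbb R:\int_{\mathbb R^2}|\widehat g(\xi)|^2(1+\|\xi\|_2^2)^s\,d\xi<\infty\}$. A function $\varphi:\mathbb R^2\to\mathbb C$ is positive definite if $\sum_{j,k=1}^n\alpha_j\overline{\alpha_k}\,\varphi(x_j-x_k)>0$ for all $n$, all pairwise distinct $x_1,\dots,x_n\in\mathbb R^2$ and all $0\ne\alpha\in\mathbb C^n$. $V(\varphi,\mathbb Z^2)=\{\sum_{k\in\mathbb Z^2}c_k\varphi(\cdot-k):\sum_k|c_k|^2<\infty\}$ (for continuous, compactly supported $\varphi$ the sums are locally finite and are taken pointwise). For $p=(\cos\theta,\sin\theta)$ the Radon transform of $f$ in direction $p$ is $\mathcal R_pf(t)=\int_{\mathbb R}f(t\cos\theta-s\sin\theta,\,t\sin\theta+s\cos\theta)\,ds$. For $S\subseteq\mathbb R^2$ let $\mathrm{dv}_S=\{x/\|x\|_2:0\ne x\in S\}$ be its set of direction vectors and $\mathcal N_S=\{0\ne y\in\mathbb R^2:\exists\,0\ne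 x\in S,\ x\cdot y=0\}$ its null set. For $x$ with $\widehat\varphi(x)>0$ let $\delta_x\in(0,\infty]$ be the largest radius such that $\widehat\varphi>0$ on the open disc $D(x,\delta_x)$, and let $\mathrm{DV}_{\widehat\varphi}=\bigcup_{x:\,\widehat\varphi(x)>0}\mathrm{dv}_{D(x,\delta_x)}$. Theorem. Let $\varphi:\mathbb R^2\to\mathbb C$ be continuous and positive definite with $\operatorname{supp}\varphi\subseteq[N_1,M_1]\times[N_2,M_2]$, $\nu_2(\varphi)>1/2$ and $\widehat\varphi(0)=0$. For real numbers $a_1,b_1,a_2,b_2$ put $$E=\big([\lceil a_1-M_1\rceil,\lfloor b_1-N_1\rfloor]\times[\lceil a_2-M_2\rceil,\lfloor b_2-N_2\rfloor]\big)\cap\mathbb Z^2,\qquad E^+=\{x-y:\ x,y\in E,\ x\neq y\}.$$ Then for every direction vector $p\in\mathrm{DV}_{\widehat\varphi}\setminus\mathrm{dv}_{\mathcal N_{E^+}}$, every $f\in V(\varphi,\mathbb Z^2)$ with $\operatorname{supp}f\subseteq[a_1,b_1]\times[a_2,b_2]$ is uniquely determined by its Radon samples $\mathcal R_pf(p\cdot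 k)$, $k\in E$: if $f,g\in V(\varphi,\mathbb Z^2)$ are both supported in $[a_1,b_1]\times[a_2,b_2]$ and $\mathcal R_pf(p\cdot k)=\mathcal R_pg(p\cdot k)$ for all $k\in E$, then $f=g$. -/

import Mathlib

open scoped ENNReal ComplexOrder ComplexConjugate

namespace SACT

noncomputable section

/-- The Euclidean plane. -/
abbrev Plane : Type := EuclideanSpace ℝ (Fin 2)

/-- The point of the plane with the given integer coordinates. -/
def latticePoint (k : Fin 2 → ℤ) : Plane := WithLp.toLp 2 (fun i => (k i : ℝ))

/-- The closed rectangle `[l 0, u 0] × [l 1, u 1]`. -/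
def rectangle (l u : Fin 2 → ℝ) : Set Plane := {x | ∀ i, l i ≤ x i ∧ x i ≤ u i}

/-- The Fourier transform `γ ↦ ∫ g(x) exp(-i x·γ) dx` of an integrable function on the plane. -/
def fourierHat (g : Plane → ℂ) (γ : Plane) : ℂ :=
  ∫ x : Plane, g x * Complex.exp (-(Complex.I * ((inner ℝ x γ : ℝ) : ℂ)))

/-- Membership of an integrable function in the Sobolev space `H^s`:
`∫ |ĝ(ξ)|² (1 + ‖ξ‖²)^s dξ < ∞`. -/
def MemSobolev (s : ℝ) (g : Plane → ℂ) : Prop :=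
  ∫⁻ ξ : Plane, ENNReal.ofReal (‖fourierHat g ξ‖ ^ 2 * (1 + ‖ξ‖ ^ 2) ^ s) < ∞

/-- The Sobolev smoothness `ν₂(g) = sup {s : g ∈ H^s}`, an extended real number. -/
def sobolevSmoothness (g : Plane → ℂ) : EReal :=
  sSup {r : EReal | ∃ s : ℝ, r = (s : EReal) ∧ MemSobolev s g}

/-- (Strictly) positive definite functions: all quadratic forms at finitely many pairwise distinct
points are real and positive away from the zero vector. The order on `ℂ` is the one for which
`0 < z` says that `z` is a positive real number. -/
def IsPositiveDefinite (φ : Plane → ℂ) : Prop :=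
  ∀ (n : ℕ) (x : Fin n → Plane), Function.Injective x → ∀ α : Fin n → ℂ, α ≠ 0 →
    0 < ∑ j, ∑ k, α j * conj (α k) * φ (x j - x k)

/-- The shift-invariant space of all `∑ k, c k * φ (· - k)` with `c ∈ ℓ²(ℤ²)`. For a continuous
and compactly supported generator the series is locally finite, and its pointwise sum is
the continuous representative of its sum in `L²`. -/
def shiftInvariantSpace (φ : Plane → ℂ) : Set (Plane → ℂ) :=
  {f | ∃ c : (Fin 2 → ℤ) → ℂ, Summable (fun k => ‖c k‖ ^ 2) ∧
    ∀ x, HasSum (fun k => c k * φ (x - latticePoint k)) (f x)}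

/-- The Radon transform of `f` with respect to the direction vector `p = (cos θ, sin θ)`: at `t`
it is the integral of `f` along the line `t p + s (-sin θ, cos θ)`, `s ∈ ℝ`. -/
def radon (p : Plane) (f : Plane → ℂ) (t : ℝ) : ℂ :=
  ∫ s : ℝ, f (t • p + s • !₂[-(p 1), p 0])

/-- The direction vectors of the nonzero elements of `S`. -/
def directionVectors (S : Set Plane) : Set Plane :=
  {p | ∃ θ : ℝ, p = !₂[Real.cos θ, Real.sin θ] ∧
    ∃ x ∈ S, x ≠ 0 ∧ x = ‖x‖ • !₂[Real.cos θ, Real.sin θ]}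

/-- The null set of `S`: the nonzero vectors orthogonal to some nonzero element of `S`. -/
def nullSet (S : Set Plane) : Set Plane :=
  {y | y ≠ 0 ∧ ∃ x ∈ S, x ≠ 0 ∧ inner ℝ x y = 0}

/-- The largest radius `δ ∈ [0, ∞]` such that `g` is positive on the open disc of center `x` and
radius `δ`. -/
def positivityRadius (g : Plane → ℂ) (x : Plane) : ℝ≥0∞ :=
  sSup {δ : ℝ≥0∞ | ∀ y, edist y x < δ → 0 < g y}

/-- The supremum that defines `positivityRadius` is a maximum. -/
theorem positivityRadius_isGreatest (g : Plane → ℂ) (x : Plane) :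
    IsGreatest {δ : ℝ≥0∞ | ∀ y, edist y x < δ → 0 < g y} (positivityRadius g x) := by
  refine ⟨fun y hy => ?_, fun δ hδ => le_sSup hδ⟩
  obtain ⟨δ, hδ, hlt⟩ := lt_sSup_iff.1 hy
  exact hδ y hlt

/-- The union, over all points `x` with `g x > 0`, of the direction vector sets of the
largest open discs around `x` on which `g` is positive. -/
def positiveDirections (g : Plane → ℂ) : Set Plane :=
  ⋃ x ∈ {x : Plane | 0 < g x},
    directionVectors {y | edist y x < positivityRadius g x}

/-- The index set
`([⌈a 0 - M 0⌉, ⌊b 0 - N 0⌋] × [⌈a 1 - M 1⌉, ⌊b 1 - N 1⌋]) ∩ ℤ²`. -/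
def indexSet (N M a b : Fin 2 → ℝ) : Finset (Fin 2 → ℤ) :=
  Finset.Icc (fun i => ⌈a i - M i⌉) (fun i => ⌊b i - N i⌋)

/-- The differences of distinct elements of `E`, as points of the plane (no element if `E` has at
most one element). -/
def differenceSet (E : Finset (Fin 2 → ℤ)) : Set Plane :=
  {z | ∃ k ∈ E, ∃ l ∈ E, k ≠ l ∧ z = latticePoint k - latticePoint l}

end

end SACT

namespace SACT

open MeasureTheory ProbabilityTheory Filter Topology
open scoped NNReal

/-! Let h be the difference of two candidates, so that its Radon samples on p·E vanish, and fix x.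
As h is φ convolved with a lattice sequence, Σ φ(x+l) h(· - l) = Σ h(x+m) φ(· - m), both sums finite
(`sum_samples_comm`). Apply R_p at p·k for k with x+k in the rectangle of h: the left side involves
only R_p h(p·(k-l)) with k-l ∈ E, hence is 0. So the vector of values h(x+m) is annihilated by the
matrix R_pφ(p·k - p·m), and definiteness of this matrix gives h(x) = 0.

Semidefiniteness passes from φ to R_pφ because a positive definite, continuous, compactly supported
function on the line has nonnegative integral; this follows by averaging over Gaussian points,
without Bochner's theorem. Definiteness: a null vector of the form stays null when an arbitrary node
s is added, so a combination of translates of R_pφ vanishes identically. The translates are distinct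
as p is orthogonal to no difference of E, and R_pφ ≠ 0 by the Fourier slice identity. -/

/-- Positive definiteness gives nonnegative quadratic forms also at points that may coincide. -/
theorem IsPositiveDefinite.sum_nonneg {φ : Plane → ℂ} (h : IsPositiveDefinite φ) {ι : Type*}
    [Fintype ι] (x : ι → Plane) (α : ι → ℂ) :
    0 ≤ ∑ j, ∑ k, α j * conj (α k) * φ (x j - x k) := by
  classical
  set S := Finset.univ.image x
  let e := S.equivFin
  let y : Fin S.card → Plane := fun i => (e.symm i : Plane)
  let c : ι → Fin S.card := fun j => e ⟨x j, Finset.mem_image_of_mem x (Finset.mem_univ j)⟩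
  have hy : Function.Injective y := Subtype.val_injective.comp e.symm.injective
  have hyc : ∀ j, y (c j) = x j := fun j => by simp [y, c]
  let β : Fin S.card → ℂ := fun i => ∑ j with c j = i, α j
  have key : ∑ j, ∑ k, α j * conj (α k) * φ (x j - x k) =
      ∑ i, ∑ i', β i * conj (β i') * φ (y i - y i') := by
    rw [← Finset.sum_fiberwise Finset.univ c fun j => ∑ k, α j * conj (α k) * φ (x j - x k)]
    refine Finset.sum_congr rfl fun i _ => ?_
    calc _ = ∑ j with c j = i, ∑ i', ∑ k with c k = i', α j * conj (α k) * φ (y i - y i') := by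
          refine Finset.sum_congr rfl fun j hj => ?_
          rw [← Finset.sum_fiberwise Finset.univ c fun k => α j * conj (α k) * φ (x j - x k)]
          refine Finset.sum_congr rfl fun i' _ => Finset.sum_congr rfl fun k hk => ?_
          rw [← (Finset.mem_filter.1 hj).2, ← (Finset.mem_filter.1 hk).2, hyc, hyc]
      _ = _ := by
          rw [Finset.sum_comm]
          refine Finset.sum_congr rfl fun i' _ => ?_
          simp_rw [β, map_sum, Finset.sum_mul_sum, Finset.sum_mul]
  rw [key]
  by_cases hβ : β = 0
  · simp [hβ]
  · exact (h _ y hy β hβ).le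

/-! ### Integrals of positive definite functions on the line -/

/-- The law of the difference of two distinct coordinates of an independent Gaussian family. -/
theorem map_sub_pi_gaussianReal (v : ℝ≥0) {ι : Type*} [Fintype ι] {i j : ι} (hij : i ≠ j) :
    (Measure.pi fun _ : ι => gaussianReal 0 v).map (fun s => s i - s j) =
      gaussianReal 0 (v + v) := by
  have hind : iIndepFun (fun (i : ι) (ω : ι → ℝ) => ω i)
      (Measure.pi fun _ : ι => gaussianReal 0 v) :=
    iIndepFun_pi (X := fun _ => id) fun _ => aemeasurable_id
  have h2 := (hind.indepFun hij).comp (φ := id) (ψ := fun x : ℝ => -x) measurable_id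
    measurable_neg
  have hev (k : ι) : (Measure.pi fun _ : ι => gaussianReal 0 v).map (fun s => s k) =
      gaussianReal 0 v :=
    (measurePreserving_eval (fun _ : ι => gaussianReal 0 v) k).map_eq
  have h3 := gaussianReal_add_gaussianReal_of_indepFun h2
    (m₁ := 0) (m₂ := 0) (v₁ := v) (v₂ := v) ?_ ?_
  · simpa [Function.comp_def, sub_eq_add_neg, Pi.add_def] using h3
  · simpa [Function.comp_def] using hev i
  · have := Measure.map_map (μ := Measure.pi fun _ : ι => gaussianReal 0 v) measurable_neg
      (measurable_pi_apply j)
    rw [show ((fun x : ℝ => -x) ∘ fun ω : ι → ℝ => ω j) = (Neg.neg ∘ fun s : ι → ℝ => s j) from rfl,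
      ← this, hev, gaussianReal_map_neg, neg_zero]

/-- Average the form over n independent Gaussian points: the diagonal contributes n K(0), the rest
n(n-1) times the integral, which dominates for large n. -/
theorem integral_gaussianReal_nonneg {K : ℝ → ℝ} (hc : Continuous K) (hcs : HasCompactSupport K)
    (hK : ∀ (n : ℕ) (s : Fin n → ℝ), 0 ≤ ∑ u, ∑ w, K (s u - s w)) (v : ℝ≥0) :
    0 ≤ ∫ r, K r ∂gaussianReal 0 (v + v) := by
  set J := ∫ r, K r ∂gaussianReal 0 (v + v)
  obtain ⟨C, hC⟩ := hcs.exists_bound_of_continuous hc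
  have main (n : ℕ) : 0 ≤ n * K 0 + n * (n - 1) * J := by
    let P := Measure.pi fun _ : Fin n => gaussianReal 0 v
    have hint (u w : Fin n) : Integrable (fun s : Fin n → ℝ => K (s u - s w)) P :=
      Integrable.of_bound (by fun_prop) C (ae_of_all _ fun s => hC _)
    have hval (u w : Fin n) : ∫ s, K (s u - s w) ∂P = if u = w then K 0 else J := by
      split_ifs with huw
      · simp [huw]
      · rw [← integral_map (φ := fun s : Fin n → ℝ => s u - s w) (by fun_prop) (by fun_prop),
          map_sub_pi_gaussianReal v huw]
    have h0 : 0 ≤ ∫ s, ∑ u, ∑ w, K (s u - s w) ∂P := integral_nonneg fun s => hK n s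
    rw [integral_finsetSum _ fun u _ => integrable_finsetSum _ fun w _ => hint u w] at h0
    simp_rw [integral_finsetSum _ fun w _ => hint _ w, hval] at h0
    have h1 (u : Fin n) : ∑ w, (if u = w then K 0 else J) = K 0 + (n - 1) * J := by
      have : ∀ w, (if u = w then K 0 else J) = (if u = w then K 0 - J else 0) + J := by
        intro w; split_ifs <;> ring
      simp_rw [this, Finset.sum_add_distrib]
      simp
      ring
    simp_rw [h1] at h0
    simp at h0
    linarith
  by_contra! hJ
  obtain ⟨n, hn⟩ := exists_nat_gt (K 0 / (-J))
  have := main (n + 1)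
  rw [div_lt_iff₀ (by linarith)] at hn
  push_cast at this
  have h3 : 0 ≤ K 0 + n * J := by
    by_contra! hlt
    nlinarith [mul_neg_of_pos_of_neg (show (0 : ℝ) < n + 1 by positivity) hlt]
  linarith

/-- Multiplied by their normalizing constants, Gaussian densities of growing variance tend to 1, so
dominated convergence applies. -/
theorem integral_nonneg_of_sum_sub_nonneg {K : ℝ → ℝ} (hc : Continuous K)
    (hcs : HasCompactSupport K)
    (hK : ∀ (n : ℕ) (s : Fin n → ℝ), 0 ≤ ∑ u, ∑ w, K (s u - s w)) :
    0 ≤ ∫ r, K r := by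
  have hint := hc.integrable_of_hasCompactSupport (μ := volume) hcs
  have h1 (n : ℕ) : 0 ≤ ∫ r, Real.exp (-r ^ 2 / (2 * (2 * (n + 1 : ℝ)))) * K r := by
    have h := integral_gaussianReal_nonneg hc hcs hK (n + 1)
    rw [integral_gaussianReal_eq_integral_smul (by positivity)] at h
    simp only [gaussianPDFReal, smul_eq_mul, mul_assoc, sub_zero] at h
    rw [integral_const_mul] at h
    have := (mul_nonneg_iff_of_pos_left (by positivity)).1 h
    have hv : (((n : ℝ≥0) + 1 + (n + 1) : ℝ≥0) : ℝ) = 2 * (n + 1) := by push_cast; ring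
    rwa [hv] at this
  refine ge_of_tendsto' (x := atTop) ?_ h1
  refine tendsto_integral_of_dominated_convergence (fun r => ‖K r‖)
    (fun n => by fun_prop) hint.norm (fun n => ae_of_all _ fun r => ?_) (ae_of_all _ fun r => ?_)
  · rw [norm_mul, Real.norm_eq_abs, Real.abs_exp]
    refine mul_le_of_le_one_left (norm_nonneg _) (Real.exp_le_one_iff.2 ?_)
    rw [neg_div]
    exact neg_nonpos.2 (by positivity)
  · have : Tendsto (fun n : ℕ => -r ^ 2 / (2 * (2 * (n + 1 : ℝ)))) atTop (𝓝 0) := by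
      refine Tendsto.div_atTop tendsto_const_nhds ?_
      exact ((tendsto_atTop_add_const_right _ _ tendsto_natCast_atTop_atTop).const_mul_atTop
        two_pos).const_mul_atTop two_pos
    simpa using ((Real.continuous_exp.tendsto 0).comp this).mul_const (K r)

theorem integral_nonneg_of_sum_sub_nonneg_complex {K : ℝ → ℂ} (hc : Continuous K)
    (hcs : HasCompactSupport K)
    (hK : ∀ (n : ℕ) (s : Fin n → ℝ), 0 ≤ ∑ u, ∑ w, K (s u - s w)) :
    0 ≤ ∫ r, K r := by
  have hint := hc.integrable_of_hasCompactSupport (μ := volume) hcs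
  have hre := integral_nonneg_of_sum_sub_nonneg (K := fun r => (K r).re) (by fun_prop)
    (hcs.comp_left Complex.zero_re) fun n s => by simpa using (Complex.nonneg_iff.1 (hK n s)).1
  have him := integral_nonneg_of_sum_sub_nonneg (K := fun r => (K r).im) (by fun_prop)
    (hcs.comp_left Complex.zero_im) fun n s => by
      simpa using (Complex.nonneg_iff.1 (hK n s)).2.le
  -- The sums are real, so both Im K and -Im K satisfy the hypothesis; hence Im K has integral 0.
  have him' := integral_nonneg_of_sum_sub_nonneg (K := fun r => -(K r).im) (by fun_prop)
    (hcs.comp_left (g := fun z : ℂ => -z.im) (by simp)) fun n s => by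
      have := (Complex.nonneg_iff.1 (hK n s)).2
      simp only [Complex.im_sum] at this
      simp [← this]
  rw [integral_neg] at him'
  rw [Complex.nonneg_iff]
  have e1 : (∫ r, K r).re = ∫ r, (K r).re := (integral_re hint).symm
  have e2 : (∫ r, K r).im = ∫ r, (K r).im := (integral_im hint).symm
  rw [e1, e2]
  exact ⟨hre, by linarith⟩

/-- Over ℂ a real-valued quadratic form is already Hermitian, so symmetry need not be assumed. -/
theorem posSemidef_of_forall_nonneg {ι : Type*} [Fintype ι] (A : Matrix ι ι ℂ)
    (h : ∀ x : ι → ℂ, 0 ≤ ∑ j, ∑ k, conj (x j) * x k * A j k) : A.PosSemidef := by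
  classical
  rw [← Matrix.isPositive_toEuclideanLin_iff, LinearMap.isPositive_iff_complex]
  intro x
  have hx := h (fun i => x i)
  have e : inner ℂ (Matrix.toEuclideanLin A x) x = conj (∑ j, ∑ k, conj (x j) * x k * A j k) := by
    rw [EuclideanSpace.inner_eq_star_dotProduct]
    simp only [dotProduct, Matrix.ofLp_toLpLin, Matrix.toLin'_apply, Matrix.mulVec, Pi.star_apply,
      RCLike.star_def, map_sum, map_mul, Finset.mul_sum, Complex.conj_conj]
    exact Finset.sum_congr rfl fun j _ => Finset.sum_congr rfl fun k _ => by ring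
  rw [e]
  generalize (∑ j, ∑ k, conj (x j) * x k * A j k) = z at hx
  obtain ⟨h1, h2⟩ := Complex.nonneg_iff.1 hx
  refine ⟨?_, by simpa using h1⟩
  apply Complex.ext <;> simp [← h2]

/-! ### The Radon transform of φ as a definite kernel -/

/-- The rotation of a vector by a right angle. -/
noncomputable def perp (p : Plane) : Plane := !₂[-(p 1), p 0]

theorem norm_perp (p : Plane) : ‖perp p‖ = ‖p‖ := by
  simp [perp, EuclideanSpace.norm_eq, Fin.sum_univ_two, add_comm]

theorem inner_perp (p : Plane) : inner ℝ p (perp p) = 0 := by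
  simp [perp, PiLp.inner_apply, Fin.sum_univ_two]
  ring

theorem radon_eq (p : Plane) (f : Plane → ℂ) (t : ℝ) :
    radon p f t = ∫ s : ℝ, f (t • p + s • perp p) := rfl

theorem isClosedEmbedding_line {q : Plane} (hq : ‖q‖ = 1) (x : Plane) :
    IsClosedEmbedding fun s : ℝ => x + s • q := by
  refine Isometry.isClosedEmbedding (Isometry.of_dist_eq fun s s' => ?_)
  rw [dist_add_left, dist_eq_norm, ← sub_smul, norm_smul, hq, mul_one, dist_eq_norm]

theorem integrable_line {p : Plane} (hp : ‖p‖ = 1) {g : Plane → ℂ} (hg : Continuous g)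
    (hgc : HasCompactSupport g) (x : Plane) : Integrable fun s : ℝ => g (x + s • perp p) :=
  (hg.comp (isClosedEmbedding_line ((norm_perp p).trans hp) x).continuous)
    |>.integrable_of_hasCompactSupport
      (hgc.comp_isClosedEmbedding (isClosedEmbedding_line ((norm_perp p).trans hp) x))

theorem hasCompactSupport_sum {X ι : Type*} [TopologicalSpace X] (s : Finset ι)
    (f : ι → X → ℂ) (h : ∀ i, HasCompactSupport (f i)) :
    HasCompactSupport fun x => ∑ i ∈ s, f i x := by
  classical
  induction s using Finset.induction_on with
  | empty => exact HasCompactSupport.zero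
  | insert i s hi ih => simp only [Finset.sum_insert hi]; exact (h i).add ih

/-- The Radon transform of a positive definite function is positive semidefinite. -/
theorem posSemidef_radon {φ : Plane → ℂ} (hc : Continuous φ) (hcs : HasCompactSupport φ)
    (hpd : IsPositiveDefinite φ) {p : Plane} (hp : ‖p‖ = 1) {ι : Type*} [Fintype ι] (t : ι → ℝ) :
    (Matrix.of fun j k => radon p φ (t j - t k)).PosSemidef := by
  refine posSemidef_of_forall_nonneg _ fun x => ?_
  have hint (j k : ι) : Integrable fun s : ℝ => φ ((t j - t k) • p + s • perp p) :=
    integrable_line hp hc hcs _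
  have e : ∑ j, ∑ k, conj (x j) * x k * (Matrix.of fun j k => radon p φ (t j - t k)) j k =
      ∫ r : ℝ, ∑ j, ∑ k, conj (x j) * x k * φ ((t j - t k) • p + r • perp p) := by
    rw [integral_finsetSum _ fun j _ => integrable_finsetSum _ fun k _ => (hint j k).const_mul _]
    refine Finset.sum_congr rfl fun j _ => ?_
    rw [integral_finsetSum _ fun k _ => (hint j k).const_mul _]
    refine Finset.sum_congr rfl fun k _ => ?_
    rw [integral_const_mul]
    rfl
  rw [e]
  refine integral_nonneg_of_sum_sub_nonneg_complex (by fun_prop) ?_ fun n s => ?_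
  · refine hasCompactSupport_sum _ _ fun j => hasCompactSupport_sum _ _ fun k => ?_
    exact (hcs.comp_isClosedEmbedding
      (isClosedEmbedding_line ((norm_perp p).trans hp) ((t j - t k) • p))).mul_left
  -- The double sum over u, w is the form of φ at the grid t_j p + s_u p^⊥, with weights independent
  -- of u. Grid points may coincide.
  · have h := hpd.sum_nonneg (fun a : Fin n × ι => t a.2 • p + s a.1 • perp p)
      fun a => conj (x a.2)
    refine h.trans_eq ?_
    simp only [Fintype.sum_prod_type]
    refine Finset.sum_congr rfl fun u _ => ?_
    rw [Finset.sum_comm]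
    refine Finset.sum_congr rfl fun w _ => Finset.sum_congr rfl fun j _ =>
      Finset.sum_congr rfl fun k _ => ?_
    rw [Complex.conj_conj, sub_smul, sub_smul, add_sub_add_comm]

/-- Distinct translates of a nonzero function whose support is bounded below are linearly
independent. -/
theorem eq_zero_of_sum_translates {ρ : ℝ → ℂ} (hne : (Function.support ρ).Nonempty)
    (hb : BddBelow (Function.support ρ)) {ι : Type*} [Fintype ι] {t : ι → ℝ} {c : ι → ℂ}
    (ht : ∀ i j, c i ≠ 0 → c j ≠ 0 → t i = t j → i = j)
    (h : ∀ s, ∑ k, ρ (s - t k) * c k = 0) : c = 0 := by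
  classical
  by_contra hc
  obtain ⟨i, hi⟩ := Function.ne_iff.1 hc
  obtain ⟨k₀, hk₀, hmin⟩ := Finset.exists_min_image (Finset.univ.filter fun k => c k ≠ 0) t
    ⟨i, by simpa using hi⟩
  simp only [Finset.mem_filter, Finset.mem_univ, true_and] at hk₀ hmin
  -- Near the infimum of the support of the leftmost translate, within the gap to the next one, only
  -- that translate can be nonzero.
  have hgap : ∀ᶠ ε : ℝ in 𝓝[>] 0, ∀ k, c k ≠ 0 → k ≠ k₀ → ε < t k - t k₀ := by
    refine eventually_all.2 fun k => ?_
    by_cases hk : c k ≠ 0 ∧ k ≠ k₀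
    · have : t k₀ < t k := lt_of_le_of_ne (hmin k hk.1) fun he => hk.2 (ht _ _ hk.1 hk₀ he.symm)
      filter_upwards [nhdsWithin_le_nhds (Iio_mem_nhds (sub_pos.2 this))] with ε hε _ _ using hε
    · exact Eventually.of_forall fun ε h1 h2 => absurd ⟨h1, h2⟩ hk
  obtain ⟨ε, hε, hpos⟩ := (hgap.and self_mem_nhdsWithin).exists
  obtain ⟨s, hs, hlt⟩ := exists_lt_of_csInf_lt hne
    (show sInf (Function.support ρ) < sInf (Function.support ρ) + ε from lt_add_of_pos_right _ hpos)
  have := h (s + t k₀)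
  rw [Finset.sum_eq_single k₀] at this
  · simp only [add_sub_cancel_right, mul_eq_zero] at this
    exact this.elim hs hk₀
  · intro k _ hk
    by_cases hck : c k = 0
    · simp [hck]
    · have h1 := hε k hck hk
      have : s + t k₀ - t k ∉ Function.support ρ := fun hmem => by
        have := csInf_le hb hmem
        linarith
      rw [Function.notMem_support.1 this, zero_mul]
  · simp

/-- The orthonormal basis formed by a unit vector and its rotation by a right angle. -/
theorem exists_orthonormalBasis {p : Plane} (hp : ‖p‖ = 1) :
    ∃ b : OrthonormalBasis (Fin 2) ℝ Plane, b 0 = p ∧ b 1 = perp p := by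
  have ho : Orthonormal ℝ ![p, perp p] := by
    rw [orthonormal_iff_ite]
    intro i j
    fin_cases i <;> fin_cases j <;>
      simp [hp, norm_perp, inner_perp, real_inner_comm p (perp p)]
  refine ⟨(basisOfOrthonormalOfCardEqFinrank ho (by simp)).toOrthonormalBasis (by simpa using ho),
    by simp, by simp⟩

/-- Integration over the plane as an iterated integral along parallel lines. -/
theorem integral_plane_eq {p : Plane} (hp : ‖p‖ = 1) {g : Plane → ℂ} (hg : Continuous g)
    (hgc : HasCompactSupport g) : ∫ x, g x = ∫ t : ℝ, ∫ s : ℝ, g (t • p + s • perp p) := by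
  obtain ⟨b, hb0, hb1⟩ := exists_orthonormalBasis hp
  let e : ℝ × ℝ ≃ᵐ Plane := ((MeasurableEquiv.finTwoArrow (α := ℝ)).symm.trans
    (MeasurableEquiv.toLp 2 (Fin 2 → ℝ))).trans b.repr.symm.toHomeomorph.toMeasurableEquiv
  have he : MeasurePreserving e (volume.prod volume) volume :=
    (b.measurePreserving_repr_symm.comp (EuclideanSpace.volume_preserving_symm_measurableEquiv_toLp
      (Fin 2)).symm).comp (volume_preserving_finTwoArrow ℝ).symm
  have hev (z : ℝ × ℝ) : e z = z.1 • p + z.2 • perp p := by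
    change b.repr.symm (WithLp.toLp 2 _) = _
    rw [← b.sum_repr_symm]
    simp [Fin.sum_univ_two, hb0, hb1]
  rw [← he.integral_comp e.measurableEmbedding, integral_prod]
  · simp_rw [hev]
  · exact (he.integrable_comp_emb e.measurableEmbedding).2
      (hg.integrable_of_hasCompactSupport hgc)

/-- Fourier slice: the exponential is constant along the lines of integration, so φ̂(r p) is the
one-dimensional transform of R_pφ at r. -/
theorem exists_radon_ne_zero {φ : Plane → ℂ} (hc : Continuous φ) (hcs : HasCompactSupport φ)
    {p : Plane} (hp : ‖p‖ = 1) {r : ℝ} (h : fourierHat φ (r • p) ≠ 0) :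
    (Function.support (radon p φ)).Nonempty := by
  by_contra! hne
  rw [Function.support_eq_empty_iff] at hne
  refine h ?_
  rw [fourierHat, integral_plane_eq hp
    (g := fun x => φ x * Complex.exp (-(Complex.I * ((inner ℝ x (r • p) : ℝ) : ℂ))))
    (by fun_prop) hcs.mul_right]
  have (t s : ℝ) : inner ℝ (t • p + s • perp p) (r • p) = t * r := by
    rw [inner_add_left, real_inner_smul_left, real_inner_smul_left, real_inner_smul_right,
      real_inner_smul_right, real_inner_self_eq_norm_sq, real_inner_comm, inner_perp, hp]
    ring
  simp_rw [this, integral_mul_const, ← radon_eq, hne]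
  simp

theorem bddBelow_support_radon {φ : Plane → ℂ} (hcs : HasCompactSupport φ) {p : Plane}
    (hp : ‖p‖ = 1) : BddBelow (Function.support (radon p φ)) := by
  obtain ⟨R, hR⟩ := hcs.isCompact.isBounded.exists_norm_le
  refine ⟨-R, fun t ht => ?_⟩
  obtain ⟨s, hs⟩ : ∃ s : ℝ, φ (t • p + s • perp p) ≠ 0 := by
    by_contra! h0
    exact ht (by simp [radon_eq, h0])
  have h1 := hR _ (subset_tsupport _ hs)
  have h2 := abs_real_inner_le_norm p (t • p + s • perp p)
  rw [inner_add_right, real_inner_smul_right, real_inner_smul_right, inner_perp,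
    real_inner_self_eq_norm_sq, hp] at h2
  simp only [one_pow, mul_one, mul_zero, add_zero, one_mul] at h2
  linarith [neg_abs_le t]

/-- If the quadratic form of the Radon transform of a positive definite function vanishes, then
all coefficients are zero, provided that the points are distinct. -/
theorem eq_zero_of_radon_quadraticForm {φ : Plane → ℂ} (hc : Continuous φ)
    (hcs : HasCompactSupport φ) (hpd : IsPositiveDefinite φ) {p : Plane} (hp : ‖p‖ = 1)
    (hne : (Function.support (radon p φ)).Nonempty) {ι : Type*} [Fintype ι] {t : ι → ℝ}
    {c : ι → ℂ} (ht : ∀ i j, c i ≠ 0 → c j ≠ 0 → t i = t j → i = j)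
    (h : ∑ j, conj (c j) * ∑ k, radon p φ (t j - t k) * c k = 0) : c = 0 := by
  refine eq_zero_of_sum_translates hne (bddBelow_support_radon hcs hp) ht fun s => ?_
  -- Adjoin the node s with coefficient 0: the form is still null, so the enlarged matrix kills the
  -- vector, and row s is the required identity.
  let t' : Option ι → ℝ := fun o => o.elim s t
  let c' : Option ι → ℂ := fun o => o.elim 0 c
  have h0 := ((posSemidef_radon hc hcs hpd hp t').dotProduct_mulVec_zero_iff c').1 (by
    simpa [dotProduct, Matrix.mulVec, Fintype.sum_option, t', c'] using h)
  simpa [dotProduct, Matrix.mulVec, Fintype.sum_option, t', c'] using congrFun h0 none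

/-! ### Lattice windows and the shift-invariant space -/

theorem isCompact_rectangle (l u : Fin 2 → ℝ) : IsCompact (rectangle l u) := by
  have : rectangle l u = (EuclideanSpace.equiv (Fin 2) ℝ).toHomeomorph ⁻¹' Set.Icc l u := by
    ext x
    exact forall_and
  rw [this]
  exact (Homeomorph.isCompact_preimage _).2 isCompact_Icc

theorem latticePoint_sub (k l : Fin 2 → ℤ) :
    latticePoint (k - l) = latticePoint k - latticePoint l := by
  ext i
  simp [latticePoint]

theorem latticePoint_add (k l : Fin 2 → ℤ) :
    latticePoint (k + l) = latticePoint k + latticePoint l := by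
  ext i
  simp [latticePoint]

/-- The lattice translates of `x` in a rectangle. -/
noncomputable def latticeWindow (l u : Fin 2 → ℝ) (x : Plane) : Finset (Fin 2 → ℤ) :=
  Finset.Icc (fun i => ⌈l i - x i⌉) (fun i => ⌊u i - x i⌋)

theorem mem_latticeWindow {l u : Fin 2 → ℝ} {x : Plane} {k : Fin 2 → ℤ} :
    k ∈ latticeWindow l u x ↔ x + latticePoint k ∈ rectangle l u := by
  simp only [latticeWindow, Finset.mem_Icc, Pi.le_def, ← forall_and, rectangle, Set.mem_ofPred_eq]
  refine forall_congr' fun i => ?_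
  rw [Int.ceil_le, Int.le_floor, sub_le_iff_le_add', le_sub_iff_add_le']
  rfl

/-- The origin of E: it contains every k-l with x+k in the rectangle of h and x+l in that of φ. -/
theorem sub_mem_indexSet {N M a b : Fin 2 → ℝ} {x : Plane} {k l : Fin 2 → ℤ}
    (hk : k ∈ latticeWindow a b x) (hl : l ∈ latticeWindow N M x) :
    k - l ∈ indexSet N M a b := by
  rw [mem_latticeWindow] at hk hl
  simp only [indexSet, Finset.mem_Icc, Pi.le_def, ← forall_and]
  intro i
  have h1 := hk i
  have h2 := hl i
  simp only [latticePoint, PiLp.add_apply] at h1 h2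
  rw [Int.ceil_le, Int.le_floor, Pi.sub_apply, Int.cast_sub]
  constructor <;> linarith

theorem locallyFinite_support_translates {φ : Plane → ℂ} {N M : Fin 2 → ℝ}
    (hsupp : Function.support φ ⊆ rectangle N M) (c : (Fin 2 → ℤ) → ℂ) :
    LocallyFinite fun k => Function.support fun x => c k * φ (x - latticePoint k) := by
  intro x
  refine ⟨Metric.ball x 1, Metric.ball_mem_nhds x one_pos, Set.Finite.subset
    (Finset.finite_toSet (Finset.Icc (fun i => ⌈x i - 1 - M i⌉) (fun i => ⌊x i + 1 - N i⌋))) ?_⟩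
  rintro k ⟨y, hy, hyx⟩
  have h1 := hsupp (right_ne_zero_of_mul hy)
  have h2 (i : Fin 2) : |y i - x i| < 1 := by
    have := PiLp.norm_apply_le (y - x) i
    rw [Metric.mem_ball, dist_eq_norm] at hyx
    exact (by simpa using this : |y i - x i| ≤ ‖y - x‖).trans_lt hyx
  simp only [Finset.coe_Icc, Set.mem_Icc, Pi.le_def, ← forall_and]
  intro i
  have h3 := h1 i
  have h4 := abs_lt.1 (h2 i)
  simp only [latticePoint, PiLp.sub_apply] at h3
  rw [Int.ceil_le, Int.le_floor]
  constructor <;> linarith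

theorem continuous_of_mem_shiftInvariantSpace {φ h : Plane → ℂ} {N M : Fin 2 → ℝ}
    (hc : Continuous φ) (hsupp : Function.support φ ⊆ rectangle N M)
    (hh : h ∈ shiftInvariantSpace φ) : Continuous h := by
  obtain ⟨c, -, hs⟩ := hh
  have hlf := locallyFinite_support_translates hsupp c
  have : h = fun x => ∑ᶠ k, c k * φ (x - latticePoint k) := by
    ext x
    rw [← (hs x).tsum_eq, tsum_eq_finsum]
    exact hlf.point_finite x
  rw [this]
  exact continuous_finsum (fun k => by fun_prop) hlf

theorem sub_mem_shiftInvariantSpace {φ f g : Plane → ℂ} (hf : f ∈ shiftInvariantSpace φ)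
    (hg : g ∈ shiftInvariantSpace φ) : f - g ∈ shiftInvariantSpace φ := by
  obtain ⟨c, hc, hcs⟩ := hf
  obtain ⟨d, hd, hds⟩ := hg
  refine ⟨c - d, ?_, fun x => ?_⟩
  · refine Summable.of_nonneg_of_le (fun k => by positivity) (fun k => ?_)
      ((hc.mul_left 2).add (hd.mul_left 2))
    have h1 := norm_sub_le (c k) (d k)
    have h2 := norm_nonneg (c k - d k)
    simp only [Pi.sub_apply]
    nlinarith [sq_nonneg (‖c k‖ - ‖d k‖)]
  · simpa only [Pi.sub_apply, sub_mul] using (hcs x).sub (hds x)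

/-- Convolving `h = ∑ c k φ(· - k)` with the samples of `φ` on `x + ℤ²` is the same as convolving
`φ` with the samples of `h` on `x + ℤ²`. -/
theorem sum_samples_comm {φ h : Plane → ℂ} {N M a b : Fin 2 → ℝ}
    (hsupp : Function.support φ ⊆ rectangle N M) (hh : h ∈ shiftInvariantSpace φ)
    (hhsupp : Function.support h ⊆ rectangle a b) (x y : Plane) :
    ∑ l ∈ latticeWindow N M x, φ (x + latticePoint l) * h (y - latticePoint l) =
      ∑ k ∈ latticeWindow a b x, h (x + latticePoint k) * φ (y - latticePoint k) := by
  classical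
  obtain ⟨c, -, hc⟩ := hh
  have hT : {k | φ (y - latticePoint k) ≠ 0}.Finite :=
    (locallyFinite_support_translates hsupp fun _ => 1).point_finite y |>.subset
      fun k hk => by simpa using hk
  set T := hT.toFinset
  have hT' : ∀ k ∉ T, φ (y - latticePoint k) = 0 := fun k hk => by simpa [T] using hk
  have e : ∑ k ∈ latticeWindow a b x, h (x + latticePoint k) * φ (y - latticePoint k) =
      ∑ k ∈ T, h (x + latticePoint k) * φ (y - latticePoint k) := by
    rw [← finsum_eq_sum_of_support_subset, ← finsum_eq_sum_of_support_subset]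
    · intro k hk
      by_contra hkT
      exact hk (mul_eq_zero_of_right _ (hT' k hkT))
    · intro k hk
      exact mem_latticeWindow.2 (hhsupp (left_ne_zero_of_mul hk))
  rw [e]
  have h1 := hasSum_sum fun l (_ : l ∈ latticeWindow N M x) =>
    (hc (y - latticePoint l)).mul_left (φ (x + latticePoint l))
  have h2 := hasSum_sum fun k (_ : k ∈ T) =>
    (hc (x + latticePoint k)).mul_right (φ (y - latticePoint k))
  refine h1.unique ?_
  convert h2 using 2 with m
  have e1 : ∑ l ∈ latticeWindow N M x,
      φ (x + latticePoint l) * (c m * φ (y - latticePoint l - latticePoint m)) =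
      ∑ᶠ l, φ (x + latticePoint l) * (c m * φ (y - latticePoint l - latticePoint m)) := by
    rw [finsum_eq_sum_of_support_subset]
    intro l hl
    exact mem_latticeWindow.2 (hsupp (left_ne_zero_of_mul hl))
  have e2 : ∑ k ∈ T, c m * φ (x + latticePoint k - latticePoint m) * φ (y - latticePoint k) =
      ∑ᶠ k, c m * φ (x + latticePoint k - latticePoint m) * φ (y - latticePoint k) := by
    rw [finsum_eq_sum_of_support_subset]
    intro k hk
    by_contra hkT
    exact hk (mul_eq_zero_of_right _ (hT' k hkT))
  -- For each fixed coefficient c m, the substitution k = l + m matches the two sums.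
  rw [e1, e2]
  refine (finsum_congr fun l => ?_).trans (finsum_comp_equiv (Equiv.addRight m))
  rw [Equiv.coe_addRight, latticePoint_add, ← add_assoc, add_sub_cancel_right, sub_sub]
  ring

/-! ### Uniqueness from Radon samples -/

theorem radon_translate {p : Plane} (hp : ‖p‖ = 1) (f : Plane → ℂ) (x : Plane) (t : ℝ) :
    radon p (fun y => f (y - x)) t = radon p f (t - inner ℝ p x) := by
  obtain ⟨b, hb0, hb1⟩ := exists_orthonormalBasis hp
  have hx : x = (inner ℝ p x) • p + (inner ℝ (perp p) x) • perp p := by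
    conv_lhs => rw [← b.sum_repr' x]
    simp [Fin.sum_univ_two, hb0, hb1]
  rw [radon_eq, radon_eq, ← integral_sub_right_eq_self
    (fun s => f ((t - inner ℝ p x) • p + s • perp p)) (inner ℝ (perp p) x)]
  refine integral_congr_ae (ae_of_all _ fun s => ?_)
  dsimp only
  congr 1
  conv_lhs => rw [hx]
  module

theorem radon_sum {p : Plane} (hp : ‖p‖ = 1) {ι : Type*} (s : Finset ι) (c : ι → ℂ)
    {f : Plane → ℂ} (hf : Continuous f) (hfc : HasCompactSupport f) (x : ι → Plane) (t : ℝ) :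
    radon p (fun y => ∑ i ∈ s, c i * f (y - x i)) t =
      ∑ i ∈ s, c i * radon p f (t - inner ℝ p (x i)) := by
  have hint (i : ι) : Integrable fun r : ℝ => f (t • p + r • perp p - x i) := by
    simpa only [add_sub_right_comm] using integrable_line hp hf hfc (t • p - x i)
  simp_rw [← radon_translate hp, radon_eq]
  rw [integral_finsetSum _ fun i _ => (hint i).const_mul _]
  simp_rw [integral_const_mul]

/-- A function of the shift-invariant space that is supported in the rectangle and whose Radon
samples vanish is zero. -/
theorem eq_zero_of_radon_samples {φ h : Plane → ℂ} {N M a b : Fin 2 → ℝ} (hc : Continuous φ)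
    (hsupp : Function.support φ ⊆ rectangle N M) (hpd : IsPositiveDefinite φ)
    (hh : h ∈ shiftInvariantSpace φ) (hhsupp : Function.support h ⊆ rectangle a b)
    {p : Plane} (hp : ‖p‖ = 1) (hne : (Function.support (radon p φ)).Nonempty)
    (hinj : ∀ k ∈ indexSet N M a b, ∀ l ∈ indexSet N M a b,
      inner ℝ p (latticePoint k) = inner ℝ p (latticePoint l) → k = l)
    (hsamples : ∀ k ∈ indexSet N M a b, radon p h (inner ℝ p (latticePoint k)) = 0) : h = 0 := by
  classical
  have hcs : HasCompactSupport φ :=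
    HasCompactSupport.of_support_subset_isCompact (isCompact_rectangle N M) hsupp
  have hhcs : HasCompactSupport h :=
    HasCompactSupport.of_support_subset_isCompact (isCompact_rectangle a b) hhsupp
  have hhc := continuous_of_mem_shiftInvariantSpace hc hsupp hh
  funext x
  -- If φ vanishes on x + ℤ², then h(x) = 0 at once. Otherwise one such l shifts the whole window of
  -- h into E, where p separates points.
  by_cases hx : ∃ l, φ (x + latticePoint l) ≠ 0
  swap
  · push Not at hx
    obtain ⟨c, -, hsum⟩ := hh
    refine (hsum x).unique ?_
    have (k : Fin 2 → ℤ) : φ (x - latticePoint k) = 0 := by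
      have := hx (-k)
      rwa [show latticePoint (-k) = -latticePoint k by ext; simp [latticePoint],
        ← sub_eq_add_neg] at this
    simp [this]
  obtain ⟨l, hl⟩ := hx
  have hlw : l ∈ latticeWindow N M x := mem_latticeWindow.2 (hsupp hl)
  have hdist : ∀ i ∈ latticeWindow a b x, ∀ j ∈ latticeWindow a b x,
      inner ℝ p (latticePoint i) = inner ℝ p (latticePoint j) → i = j := by
    intro i hi j hj hij
    refine sub_left_injective (b := l) (hinj _ (sub_mem_indexSet hi hlw) _
      (sub_mem_indexSet hj hlw) ?_)
    rw [latticePoint_sub, latticePoint_sub, inner_sub_right, inner_sub_right, hij]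
  have hform (k : Fin 2 → ℤ) (hk : k ∈ latticeWindow a b x) :
      ∑ m ∈ latticeWindow a b x, h (x + latticePoint m) *
        radon p φ (inner ℝ p (latticePoint k) - inner ℝ p (latticePoint m)) = 0 := by
    rw [← radon_sum hp _ _ hc hcs, ← funext (sum_samples_comm hsupp hh hhsupp x),
      radon_sum hp _ _ hhc hhcs]
    refine Finset.sum_eq_zero fun l hl => ?_
    rw [← inner_sub_right, ← latticePoint_sub, hsamples _ (sub_mem_indexSet hk hl), mul_zero]
  have hzero := eq_zero_of_radon_quadraticForm (ι := latticeWindow a b x)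
    (c := fun k => h (x + latticePoint k)) (t := fun k => inner ℝ p (latticePoint k))
    hc hcs hpd hp hne
    (fun i j _ _ hij => Subtype.ext (hdist i i.2 j j.2 hij)) (by
      refine Finset.sum_eq_zero fun k _ => ?_
      have := hform k k.2
      rw [← Finset.sum_coe_sort] at this
      simp_rw [mul_comm (radon p φ _), this, mul_zero])
  by_contra h0
  have h00 : latticePoint 0 = 0 := by ext; simp [latticePoint]
  have hmem : (0 : Fin 2 → ℤ) ∈ latticeWindow a b x :=
    mem_latticeWindow.2 (by rw [h00, add_zero]; exact hhsupp h0)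
  exact h0 (by simpa [h00] using congrFun hzero ⟨0, hmem⟩)

end SACT

theorem theorem5p10 (φ : SACT.Plane → ℂ) (N M a b : Fin 2 → ℝ)
    (hcont : Continuous φ)
    (hsupp : Function.support φ ⊆ SACT.rectangle N M)
    (hpd : SACT.IsPositiveDefinite φ)
    (hsmooth : ((1 / 2 : ℝ) : EReal) < SACT.sobolevSmoothness φ)
    (hvanish : SACT.fourierHat φ 0 = 0)
    (p : SACT.Plane)
    (hp : p ∈ SACT.positiveDirections (SACT.fourierHat φ) \
      SACT.directionVectors (SACT.nullSet (SACT.differenceSet (SACT.indexSet N M a b))))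
    (f g : SACT.Plane → ℂ)
    (hf : f ∈ SACT.shiftInvariantSpace φ)
    (hfsupp : Function.support f ⊆ SACT.rectangle a b)
    (hg : g ∈ SACT.shiftInvariantSpace φ)
    (hgsupp : Function.support g ⊆ SACT.rectangle a b)
    (hsamples : ∀ k ∈ SACT.indexSet N M a b,
      SACT.radon p f (inner ℝ p (SACT.latticePoint k)) =
        SACT.radon p g (inner ℝ p (SACT.latticePoint k))) :
    f = g := by
  obtain ⟨hpos, hnull⟩ := hp
  simp only [SACT.positiveDirections, Set.mem_iUnion] at hpos
  obtain ⟨z, -, θ, hpθ, y, hy, -, hyp⟩ := hpos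
  have hp1 : ‖p‖ = 1 := by
    simp [hpθ, EuclideanSpace.norm_eq, Fin.sum_univ_two]
  have hφy : SACT.fourierHat φ (‖y‖ • p) ≠ 0 := by
    rw [hpθ, ← hyp]
    exact ((SACT.positivityRadius_isGreatest _ z).1 y hy).ne'
  have hcs : HasCompactSupport φ :=
    HasCompactSupport.of_support_subset_isCompact (SACT.isCompact_rectangle N M) hsupp
  have hp0 : p ≠ 0 := by
    rintro rfl
    simp at hp1
  have hcomp {h : SACT.Plane → ℂ} (hh : Function.support h ⊆ SACT.rectangle a b) :
      HasCompactSupport h :=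
    HasCompactSupport.of_support_subset_isCompact (SACT.isCompact_rectangle a b) hh
  rw [← sub_eq_zero]
  refine SACT.eq_zero_of_radon_samples hcont hsupp hpd (SACT.sub_mem_shiftInvariantSpace hf hg)
    ((Function.support_sub f g).trans (Set.union_subset hfsupp hgsupp)) hp1
    (SACT.exists_radon_ne_zero hcont hcs hp1 hφy) (fun k hk l hl hkl => ?_) fun k hk => ?_
  · by_contra hne
    -- If p·k = p·l with k ≠ l, then p itself lies in the excluded null set.
    refine hnull ⟨θ, hpθ, p, ⟨hp0, SACT.latticePoint k - SACT.latticePoint l,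
      ⟨k, hk, l, hl, hne, rfl⟩, fun h0 => hne ?_, ?_⟩, hp0, ?_⟩
    · funext i
      have := congrArg (fun v : SACT.Plane => v i) h0
      simpa [SACT.latticePoint, sub_eq_zero] using this
    · rw [real_inner_comm, inner_sub_right, hkl, sub_self]
    · rw [hp1, one_smul, hpθ]
  · have h1 := MeasureTheory.integral_sub
      (SACT.integrable_line hp1 (SACT.continuous_of_mem_shiftInvariantSpace hcont hsupp hf)
        (hcomp hfsupp) (inner ℝ p (SACT.latticePoint k) • p))
      (SACT.integrable_line hp1 (SACT.continuous_of_mem_shiftInvariantSpace hcont hsupp hg)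
        (hcomp hgsupp) (inner ℝ p (SACT.latticePoint k) • p))
    exact h1.trans (sub_eq_zero.2 (hsamples k hk))
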